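/- Let $\mathcal Y$ be a separable real Hilbert space, let $d,m\ge 1$ be integers, let $\mathcal X=[0,1]^d\subset\mathbb R^d$, and let $B\subset\mathcal Y$. For a subset $E$ of a metric space, let $N(\delta,E)\in\{0,1,2,\dots\}\cup\{\infty\}$ be the minimal number of closed balls of radius $\delta$ with centres in $E$ that cover $E$. Suppose that at least one of the following holds: 1. $B$ is totally bounded and homogeneous, i.e. there are constants $M,\tau$ such that $N(r,\{y\in B:\|y-z\|_{\mathcal Y}\le R\})\le M(R/r)^{\tau}$ for all $z\in B$ and all $0<r<R$; 2. $B$ has finite upper box-counting dimension, i.e. $\limsup_{\delta\downarrow 0}\frac{\log N(\delta,B)}{-\log\delta}<\infty$; 3. there are constants $M,\tau>0$ such that $N(\varepsilon,B)\le\exp\{M\varepsilon^{-\tau}\}$ for all $\varepsilon>0$. Let $\mathcal G^m_B$ be the set of all continuous functions $g:\mathcal X\to\mathcal Y$ with values in $B$ that are $m$ times (Fréchet) differentiable in the interior of $\mathcal X$ and whose partial derivatives satisfy $D^pg(x)\in B$ for every $x$ in the interior of $\mathcal X$ and every multi-index $p\in\{0,1,2,\dots\}^d$ with $p_1+\dots+p_d\le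 m$. Let $X_1,X_2,\dots$ be i.i.d. random variables with values in $\mathcal X$ and distribution $P$ (an arbitrary Borel probability measure on $\mathcal X$), defined on a probability space $(\Omega,\mathscr F,\mathbb P)$. For a Bochner $P$-integrable function $g:\mathcal X\to\mathcal Y$ write $P_ng=\frac1n\sum_{i=1}^n g(X_i)$ and $Pg=\int g\,dP$ (Bochner integral). Then $\mathcal G^m_B$ is a Glivenko–Cantelli class: every $g\in\mathcal G^m_B$ is Bochner $P$-integrable, and $$\sup_{g\in\mathcal G^m_B}\|P_ng-Pg\|_{\mathcal Y}\longrightarrow 0\quad\text{in probability as } n\to\infty,$$ that is, for every $\varepsilon>0$ the (outer) probability of the event $\{\sup_{g\in\mathcal G^m_B}\|P_ng-Pg\|_{\mathcal Y}\ge\varepsilon\}$ tends to $0$. -/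

import Mathlib

open MeasureTheory ProbabilityTheory Filter Topology
open scoped NNReal ENNReal

noncomputable section

/-! ### Covering-number conditions on a subset of a metric space

`Metric.coveringNumber r E : ℕ∞` is the minimal number of closed balls of radius `r` with
centres in `E` that cover `E` (and `⊤` if there is no finite cover). -/

section Covering

variable {Z : Type*} [MetricSpace Z]

/-- `E` is `(M, τ)`-homogeneous: `N(r, B(z,R) ∩ E) ≤ M (R/r)^τ` for all `z ∈ E`, `0 < r < R`. -/
def IsHomogeneousWith (M τ : ℝ) (E : Set Z) : Prop :=
  ∀ z ∈ E, ∀ r R : ℝ≥0, 0 < r → r < R →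
    (Metric.coveringNumber r (Metric.closedBall z (R : ℝ) ∩ E) : ℝ≥0∞) ≤
      ENNReal.ofReal (M * ((R : ℝ) / (r : ℝ)) ^ τ)

/-- `E` is homogeneous: it is `(M, τ)`-homogeneous for some constants `M`, `τ`. -/
def IsHomogeneous (E : Set Z) : Prop :=
  ∃ M τ : ℝ, IsHomogeneousWith M τ E

/-- The upper box-counting dimension `limsup_{δ → 0+} log N(δ, E) / (-log δ)`, as an extended real
number (with `log ⊤ = ⊤`, so that it is `⊤` for a set that is not totally bounded). -/
def upperBoxDim (E : Set Z) : EReal :=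
  limsup (fun δ : ℝ≥0 =>
      ENNReal.log (Metric.coveringNumber δ E : ℝ≥0∞) / ((-Real.log (δ : ℝ) : ℝ) : EReal))
    (𝓝[>] (0 : ℝ≥0))

/-- The covering numbers of `E` grow at most exponentially:
`N(ε, E) ≤ exp (M ε^(-τ))` for all `ε > 0`, for some `M, τ > 0`. -/
def HasExpCoveringNumbers (E : Set Z) : Prop :=
  ∃ M τ : ℝ, 0 < M ∧ 0 < τ ∧ ∀ ε : ℝ≥0, 0 < ε →
    (Metric.coveringNumber ε E : ℝ≥0∞) ≤ ENNReal.ofReal (Real.exp (M * (ε : ℝ) ^ (-τ)))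

end Covering

/-! ### The class of smooth functions on the unit cube -/

section Smooth

/-- The closed unit cube in `ℝ^d`. -/
def unitCube (d : ℕ) : Set (EuclideanSpace ℝ (Fin d)) :=
  {x | ∀ j, 0 ≤ x j ∧ x j ≤ 1}

variable {d : ℕ} {Y : Type*} [NormedAddCommGroup Y] [InnerProductSpace ℝ Y]

/-- The partial derivative `∂_l f`, as a function of the point. -/
def partialDeriv (l : Fin d) (f : EuclideanSpace ℝ (Fin d) → Y) : EuclideanSpace ℝ (Fin d) → Y :=
  fun x => lineDeriv ℝ f x (EuclideanSpace.single l (1 : ℝ))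

/-- The iterated partial derivative `D^p f = ∂_1^{p_1} ⋯ ∂_d^{p_d} f` for a multi-index `p`. -/
def multiDeriv (p : Fin d → ℕ) (f : EuclideanSpace ℝ (Fin d) → Y) :
    EuclideanSpace ℝ (Fin d) → Y :=
  (List.finRange d).foldr (fun l h => (partialDeriv l)^[p l] h) f

/-- `f` is `m` times (Fréchet) differentiable at every point of `U` (meant for open `U`). -/
def IsTimesDifferentiableOn (m : ℕ) (f : EuclideanSpace ℝ (Fin d) → Y)
    (U : Set (EuclideanSpace ℝ (Fin d))) : Prop :=
  ∀ k < m, ∀ x ∈ U, DifferentiableAt ℝ (iteratedFDeriv ℝ k f) x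

/-- A function on the cube, extended by `0` to `ℝ^d`; only used to take derivatives at
interior points of the cube, where the extension plays no role. -/
def cubeExtend (g : unitCube d → Y) : EuclideanSpace ℝ (Fin d) → Y :=
  Function.extend Subtype.val g 0

/-- The class `𝒢^m_B` of functions `g` from the unit cube to `Y` with values in `B`, continuous on
the cube, `m` times differentiable in its interior, with all partial derivatives of order at most
`m` there lying in `B`. At boundary points nothing is asked beyond continuity and `g x ∈ B`: any
convention that also prescribes (one-sided or continuously extended) derivatives at the boundary
gives a subclass of this one. -/
def smoothClass (d m : ℕ) (B : Set Y) : Set (unitCube d → Y) :=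
  {g | Continuous g ∧ (∀ x, g x ∈ B) ∧
    IsTimesDifferentiableOn m (cubeExtend g) (interior (unitCube d)) ∧
    ∀ p : Fin d → ℕ, ∑ j, p j ≤ m →
      ∀ x ∈ interior (unitCube d), multiDeriv p (cubeExtend g) x ∈ B}

end Smooth

/-! ### Glivenko–Cantelli classes -/

section GlivenkoCantelli

variable {Ω 𝒳 Y : Type*} [MeasurableSpace Ω] [MeasurableSpace 𝒳]
  [NormedAddCommGroup Y] [InnerProductSpace ℝ Y]

/-- The empirical mean `P_n g = (1/n) ∑_{i=1}^n g(X_i)`. -/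
def empiricalMean (X : ℕ → Ω → 𝒳) (n : ℕ) (ω : Ω) (g : 𝒳 → Y) : Y :=
  (n : ℝ)⁻¹ • ∑ i ∈ Finset.range n, g (X i ω)

/-- `‖P_n - P‖_𝒢 = sup_{g ∈ 𝒢} ‖P_n g - P g‖`, with values in `[0, ∞]`. -/
def empiricalDeviation (X : ℕ → Ω → 𝒳) (P : Measure 𝒳) (𝒢 : Set (𝒳 → Y)) (n : ℕ) (ω : Ω) :
    ℝ≥0∞ :=
  ⨆ g ∈ 𝒢, ‖empiricalMean X n ω g - ∫ x, g x ∂P‖ₑ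

/-- `𝒢` is a class of Bochner `P`-integrable functions with `‖P_n - P‖_𝒢 → 0` in probability.
The supremum need not be measurable; `μ` applied to an arbitrary set is outer probability. -/
def IsGlivenkoCantelli (μ : Measure Ω) (X : ℕ → Ω → 𝒳) (P : Measure 𝒳) (𝒢 : Set (𝒳 → Y)) :
    Prop :=
  (∀ g ∈ 𝒢, Integrable g P) ∧
  ∀ ε : ℝ≥0∞, 0 < ε →
    Tendsto (fun n : ℕ => μ {ω | ε ≤ empiricalDeviation X P 𝒢 n ω}) atTop (𝓝 0)

end GlivenkoCantelli

end

/-! ### Boundedness from covering numbers -/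

section Bounded

variable {Z : Type*} [MetricSpace Z] {E : Set Z}

/-! Each covering condition forces `B` to be bounded, and boundedness suffices. Since `m ≥ 1`, first
partials are uniformly bounded, so the class is uniformly Lipschitz
(`lipschitzWith_of_mem_smoothClass`). Replacing `g` by `g ∘ π`, with `π` a finite-valued
quantisation of the cube, then costs little uniformly in `g`, and the deviation of `g ∘ π` is
controlled by those of the finitely many cells of `π` (`norm_empiricalMean_sub_integral_le`). The
strong law handles each cell, so no entropy bound on the class is needed. -/

theorem isBounded_of_coveringNumber_ne_top {r : ℝ≥0} (h : Metric.coveringNumber r E ≠ ⊤) :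
    Bornology.IsBounded E := by
  obtain ⟨C, -, hfin, hC, -⟩ := Metric.exists_set_encard_eq_coveringNumber h
  rw [Metric.isCover_iff_subset_iUnion_closedBall] at hC
  exact ((Bornology.isBounded_biUnion hfin).2 fun _ _ => Metric.isBounded_closedBall).subset hC

theorem HasExpCoveringNumbers.isBounded (h : HasExpCoveringNumbers E) : Bornology.IsBounded E := by
  obtain ⟨M, τ, -, -, h⟩ := h
  refine isBounded_of_coveringNumber_ne_top (r := 1) fun htop => ?_
  have := h 1 one_pos
  rw [htop] at this
  simp at this

theorem isBounded_of_upperBoxDim_lt_top (h : upperBoxDim E < ⊤) : Bornology.IsBounded E := by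
  have hlim := eventually_lt_of_limsup_lt h
  -- For `δ < 1` the denominator `-log δ` is positive, so an infinite covering number would make the
  -- quotient `⊤`.
  have hlt : ∀ᶠ δ : ℝ≥0 in 𝓝[>] 0, δ < 1 :=
    eventually_nhdsWithin_of_eventually_nhds (eventually_lt_nhds one_pos)
  obtain ⟨δ, ⟨hδ, hδ1⟩, hδ0⟩ := ((hlim.and hlt).and self_mem_nhdsWithin).exists
  refine isBounded_of_coveringNumber_ne_top (r := δ) fun htop => ?_
  have hlog : (0 : ℝ) < -Real.log δ :=
    neg_pos.2 (Real.log_neg (NNReal.coe_pos.2 hδ0) (by exact_mod_cast hδ1))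
  rw [htop, ENat.toENNReal_top, ENNReal.log_top,
    EReal.top_div_of_pos_ne_top (by exact_mod_cast hlog) (EReal.coe_ne_top _)] at hδ
  exact lt_irrefl _ hδ

end Bounded

section UnitCube

theorem convex_unitCube (d : ℕ) : Convex ℝ (unitCube d) := by
  intro x hx y hy a b ha hb hab j
  simp only [PiLp.add_apply, PiLp.smul_apply, smul_eq_mul]
  obtain ⟨hx0, hx1⟩ := hx j
  obtain ⟨hy0, hy1⟩ := hy j
  exact ⟨by positivity, by nlinarith⟩

theorem isCompact_unitCube (d : ℕ) : IsCompact (unitCube d) := by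
  have h : unitCube d =
      (EuclideanSpace.equiv (Fin d) ℝ).symm '' Set.Icc (0 : Fin d → ℝ) 1 := by
    rw [ContinuousLinearEquiv.image_symm_eq_preimage]
    ext x
    simp [unitCube, Set.mem_Icc, Pi.le_def, forall_and]
  rw [h]
  exact isCompact_Icc.image (EuclideanSpace.equiv (Fin d) ℝ).symm.continuous

instance (d : ℕ) : CompactSpace (unitCube d) :=
  isCompact_iff_compactSpace.1 (isCompact_unitCube d)

theorem interior_unitCube_nonempty (d : ℕ) : (interior (unitCube d)).Nonempty := by
  let c : EuclideanSpace ℝ (Fin d) := WithLp.toLp 2 fun _ => 1 / 2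
  refine ⟨c, mem_interior_iff_mem_nhds.2 ?_⟩
  filter_upwards [Metric.ball_mem_nhds c (one_half_pos (α := ℝ))] with x hx j
  have h : |x j - 1 / 2| < 1 / 2 := by
    have h1 := PiLp.norm_apply_le (x - c) j
    rw [Metric.mem_ball, dist_eq_norm] at hx
    simpa [c] using h1.trans_lt hx
  rw [abs_lt] at h
  constructor <;> linarith

theorem closure_interior_unitCube (d : ℕ) : closure (interior (unitCube d)) = unitCube d := by
  rw [(convex_unitCube d).closure_interior_eq_closure_of_nonempty_interior
    (interior_unitCube_nonempty d), (isCompact_unitCube d).isClosed.closure_eq]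

end UnitCube

/-! ### Uniform Lipschitz bound -/

section Lipschitz

variable {d : ℕ} {Y : Type*} [NormedAddCommGroup Y] [InnerProductSpace ℝ Y]

theorem multiDeriv_single (l : Fin d) (f : EuclideanSpace ℝ (Fin d) → Y) :
    multiDeriv (Pi.single l 1) f = partialDeriv l f := by
  -- Generalising to duplicate-free lists makes induction possible.
  have key : ∀ L : List (Fin d), L.Nodup →
      L.foldr (fun k h => (partialDeriv k)^[(Pi.single l 1 : Fin d → ℕ) k] h) f =
        if l ∈ L then partialDeriv l f else f := by
    intro L hL
    induction L with
    | nil => simp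
    | cons a t ih =>
      obtain ⟨hat, ht⟩ := List.nodup_cons.1 hL
      rw [List.foldr_cons, ih ht]
      by_cases hal : a = l
      · subst hal
        simp [hat]
      · simp [hal, Ne.symm hal]
  rw [multiDeriv, key _ (List.nodup_finRange d), if_pos (List.mem_finRange l)]

/-- Bounding each coordinate of `v` by `‖v‖` gives the crude factor `d`, which is enough here. -/
theorem norm_fderiv_le_of_norm_partialDeriv_le {f : EuclideanSpace ℝ (Fin d) → Y}
    {x : EuclideanSpace ℝ (Fin d)} {C : ℝ} (hC : 0 ≤ C) (hf : DifferentiableAt ℝ f x)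
    (h : ∀ l, ‖partialDeriv l f x‖ ≤ C) : ‖fderiv ℝ f x‖ ≤ d * C := by
  refine ContinuousLinearMap.opNorm_le_bound _ (by positivity) fun v => ?_
  have hv : v = ∑ l, v l • EuclideanSpace.single l (1 : ℝ) := by
    simpa using ((EuclideanSpace.basisFun (Fin d) ℝ).sum_repr v).symm
  calc ‖fderiv ℝ f x v‖ = ‖∑ l, v l • partialDeriv l f x‖ := by
        conv_lhs => rw [hv]
        simp [partialDeriv, hf.lineDeriv_eq_fderiv]
    _ ≤ ∑ l : Fin d, ‖v‖ * C := by
        refine norm_sum_le_of_le _ fun l _ => ?_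
        rw [norm_smul]
        exact mul_le_mul (PiLp.norm_apply_le v l) (h l) (norm_nonneg _) (norm_nonneg _)
    _ = d * C * ‖v‖ := by simp; ring

theorem cubeExtend_apply {Y : Type*} [NormedAddCommGroup Y] (g : unitCube d → Y) (x : unitCube d) : cubeExtend g x = g x :=
  Subtype.val_injective.extend_apply g 0 x

/-- The mean value inequality applies on the convex interior; continuity carries the bound to its
closure, the whole cube. -/
theorem lipschitzWith_of_mem_smoothClass {m : ℕ} (hm : 1 ≤ m) {B : Set Y} {C : ℝ≥0}
    (hC : ∀ y ∈ B, ‖y‖ ≤ C) {g : unitCube d → Y} (hg : g ∈ smoothClass d m B) :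
    LipschitzWith (d * C) g := by
  obtain ⟨hcont, -, hdiff, hB⟩ := hg
  have hdiff' : ∀ x ∈ interior (unitCube d), DifferentiableAt ℝ (cubeExtend g) x := by
    intro x hx
    have h := hdiff 0 (by omega) x hx
    rwa [iteratedFDeriv_zero_eq_comp,
      LinearIsometryEquiv.comp_differentiableAt_iff] at h
  have hint : LipschitzOnWith (d * C) (cubeExtend g) (interior (unitCube d)) := by
    refine (convex_unitCube d).interior.lipschitzOnWith_of_nnnorm_fderiv_le hdiff' fun x hx => ?_
    rw [← NNReal.coe_le_coe]
    push_cast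
    refine norm_fderiv_le_of_norm_partialDeriv_le C.2 (hdiff' x hx) fun l => hC _ ?_
    rw [← multiDeriv_single]
    exact hB _ (by simpa [Finset.sum_pi_single'] using hm) x hx
  have hcl : LipschitzOnWith (d * C) (cubeExtend g) (unitCube d) := by
    rw [← closure_interior_unitCube]
    refine hint.closure ?_
    rw [closure_interior_unitCube, continuousOn_iff_continuous_domRestrict]
    convert hcont using 1
    exact funext (cubeExtend_apply g)
  intro x y
  have h := hcl x.2 y.2
  rwa [cubeExtend_apply, cubeExtend_apply] at h

end Lipschitz

/-! ### Quantisation and the law of large numbers -/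

section Partition

variable {𝒳 : Type*} [PseudoMetricSpace 𝒳] [CompactSpace 𝒳] [Nonempty 𝒳]
  [MeasurableSpace 𝒳] [BorelSpace 𝒳]

theorem exists_simpleFunc_dist_le {δ : ℝ} (hδ : 0 < δ) :
    ∃ π : SimpleFunc 𝒳 𝒳, ∀ x, dist (π x) x ≤ δ := by
  let e := TopologicalSpace.denseSeq 𝒳
  have hcover : (Set.univ : Set 𝒳) ⊆ ⋃ k, Metric.ball (e k) δ := by
    intro x _
    obtain ⟨k, hk⟩ := (TopologicalSpace.denseRange_denseSeq 𝒳).exists_dist_lt x hδ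
    exact Set.mem_iUnion.2 ⟨k, hk⟩
  obtain ⟨t, ht⟩ := isCompact_univ.elim_finite_subcover _ (fun _ => Metric.isOpen_ball) hcover
  -- `nearestPt e N` chooses among `e 0, …, e N`, so the largest index of the finite subcover is
  -- enough.
  refine ⟨SimpleFunc.nearestPt e (t.sup id), fun x => ?_⟩
  obtain ⟨k, hk, hxk⟩ := Set.mem_iUnion₂.1 (ht (Set.mem_univ x))
  have h := SimpleFunc.edist_nearestPt_le e x (Finset.le_sup (f := id) hk)
  rw [edist_dist, edist_dist] at h
  refine ((ENNReal.ofReal_le_ofReal_iff dist_nonneg).1 h).trans ?_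
  rw [dist_comm]
  exact (Metric.mem_ball.1 hxk).le

end Partition

section EmpiricalMeasure

variable {Ω 𝒳 : Type*} [MeasurableSpace Ω] [MeasurableSpace 𝒳]
  {μ : Measure Ω} {P : Measure 𝒳} {X : ℕ → Ω → 𝒳}

/-- `P_n(A) - P(A)`, the deviation of the empirical measure of the set `A`. -/
noncomputable def setDeviation (X : ℕ → Ω → 𝒳) (P : Measure 𝒳) (A : Set 𝒳) (n : ℕ) (ω : Ω) : ℝ :=
  empiricalMean X n ω (A.indicator 1) - P.real A

theorem measurable_setDeviation (hX : ∀ i, Measurable (X i)) {A : Set 𝒳} (hA : MeasurableSet A)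
    (n : ℕ) : Measurable (setDeviation X P A n) := by
  have h : ∀ i, Measurable fun ω => A.indicator (1 : 𝒳 → ℝ) (X i ω) := fun i =>
    (measurable_one.indicator hA).comp (hX i)
  unfold setDeviation empiricalMean
  fun_prop

theorem tendsto_setDeviation [IsProbabilityMeasure μ] (hX : ∀ i, Measurable (X i))
    (hlaw : ∀ i, μ.map (X i) = P) (hindep : iIndepFun X μ) {A : Set 𝒳} (hA : MeasurableSet A) :
    ∀ᵐ ω ∂μ, Tendsto (fun n => setDeviation X P A n ω) atTop (𝓝 0) := by
  have hmeas : Measurable (A.indicator (1 : 𝒳 → ℝ)) := measurable_one.indicator hA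
  have hint : Integrable (fun ω => A.indicator (1 : 𝒳 → ℝ) (X 0 ω)) μ := by
    refine Integrable.of_bound (hmeas.comp (hX 0)).aestronglyMeasurable 1 (ae_of_all _ fun ω => ?_)
    by_cases h : X 0 ω ∈ A <;> simp [h]
  have hslln := strong_law_ae_real (fun i ω => A.indicator (1 : 𝒳 → ℝ) (X i ω)) hint
    (fun i j hij => (hindep.indepFun hij).comp hmeas hmeas)
    (fun i => (IdentDistrib.mk (hX i).aemeasurable (hX 0).aemeasurable
      ((hlaw i).trans (hlaw 0).symm)).comp hmeas)
  have hmean : ∫ ω, A.indicator (1 : 𝒳 → ℝ) (X 0 ω) ∂μ = P.real A := by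
    rw [← integral_map (hX 0).aemeasurable hmeas.aestronglyMeasurable, hlaw, integral_indicator_one hA]
  filter_upwards [hslln] with ω hω
  rw [hmean] at hω
  have h := hω.sub_const (P.real A)
  rw [sub_self] at h
  refine h.congr fun n => ?_
  rw [setDeviation, empiricalMean, smul_eq_mul, div_eq_inv_mul]

end EmpiricalMeasure

section Deviation

variable {Ω 𝒳 Y : Type*} [NormedAddCommGroup Y] [InnerProductSpace ℝ Y] {X : ℕ → Ω → 𝒳}

theorem norm_empiricalMean_le {g : 𝒳 → Y} {C : ℝ} (hC : 0 ≤ C) (h : ∀ x, ‖g x‖ ≤ C)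
    (n : ℕ) (ω : Ω) : ‖empiricalMean X n ω g‖ ≤ C := by
  rw [empiricalMean, norm_smul, norm_inv, Real.norm_natCast]
  have hsum : ‖∑ i ∈ Finset.range n, g (X i ω)‖ ≤ n * C := by
    simpa using norm_sum_le_of_le (Finset.range n) fun i _ => h (X i ω)
  -- For `n = 0` the empirical mean is `0`, as `0⁻¹ = 0`.
  rcases Nat.eq_zero_or_pos n with rfl | hn
  · simpa using hC
  · rw [inv_mul_le_iff₀ (by exact_mod_cast hn)]
    exact hsum

theorem empiricalMean_sub (g h : 𝒳 → Y) (n : ℕ) (ω : Ω) :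
    empiricalMean X n ω (g - h) = empiricalMean X n ω g - empiricalMean X n ω h := by
  simp [empiricalMean, smul_sub]

variable [MeasurableSpace 𝒳] {P : Measure 𝒳}

theorem comp_simpleFunc_eq_sum (g : 𝒳 → Y) (π : SimpleFunc 𝒳 𝒳) (x : 𝒳) :
    g (π x) = ∑ y ∈ π.range, (π ⁻¹' {y}).indicator (1 : 𝒳 → ℝ) x • g y := by
  rw [Finset.sum_eq_single (π x)]
  · simp
  · intro y _ hy
    simp [Ne.symm hy]
  · intro h
    exact absurd (SimpleFunc.mem_range_self π x) h

theorem empiricalMean_comp_simpleFunc_sub_integral [CompleteSpace Y] [IsFiniteMeasure P]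
    (g : 𝒳 → Y) (π : SimpleFunc 𝒳 𝒳) (n : ℕ) (ω : Ω) :
    empiricalMean X n ω (fun x => g (π x)) - ∫ x, g (π x) ∂P =
      ∑ y ∈ π.range, setDeviation X P (π ⁻¹' {y}) n ω • g y := by
  have hA : ∀ y, MeasurableSet (π ⁻¹' {y}) := π.measurableSet_fiber
  have hint : ∫ x, g (π x) ∂P = ∑ y ∈ π.range, P.real (π ⁻¹' {y}) • g y := by
    simp_rw [comp_simpleFunc_eq_sum g π]
    have hone : ∀ y, Integrable ((π ⁻¹' {y}).indicator (1 : 𝒳 → ℝ)) P := fun y =>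
      (integrable_const (1 : ℝ)).indicator (hA y)
    rw [integral_finsetSum _ fun y _ => (hone y).smul_const _]
    refine Finset.sum_congr rfl fun y _ => ?_
    rw [integral_smul_const, integral_indicator_one (hA y)]
  have hemp : empiricalMean X n ω (fun x => g (π x)) =
      ∑ y ∈ π.range, empiricalMean X n ω ((π ⁻¹' {y}).indicator (1 : 𝒳 → ℝ)) • g y := by
    simp only [empiricalMean, comp_simpleFunc_eq_sum g π]
    rw [Finset.sum_comm, Finset.smul_sum]
    exact Finset.sum_congr rfl fun y _ => by rw [← Finset.sum_smul, smul_assoc]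
  rw [hint, hemp, ← Finset.sum_sub_distrib]
  exact Finset.sum_congr rfl fun y _ => by rw [setDeviation, sub_smul]

/-- Passing to `g ∘ π` costs `η` in the empirical mean and `η` in the integral. The bound sees `g`
only through `C` and `η`, hence is uniform over the class. -/
theorem norm_empiricalMean_sub_integral_le [CompleteSpace Y] [IsProbabilityMeasure P]
    {g : 𝒳 → Y} (hg : Integrable g P) {C η : ℝ} (hη : 0 ≤ η) (hC : ∀ x, ‖g x‖ ≤ C)
    (π : SimpleFunc 𝒳 𝒳) (hπ : ∀ x, ‖g x - g (π x)‖ ≤ η) (n : ℕ) (ω : Ω) :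
    ‖empiricalMean X n ω g - ∫ x, g x ∂P‖ ≤
      2 * η + C * ∑ y ∈ π.range, |setDeviation X P (π ⁻¹' {y}) n ω| := by
  have hgπ : Integrable (fun x => g (π x)) P := by
    rw [show (fun x => g (π x)) = π.map g from (SimpleFunc.coe_map g π).symm]
    exact SimpleFunc.integrable_of_isFiniteMeasure _
  have hemp : ‖empiricalMean X n ω (g - fun x => g (π x))‖ ≤ η := norm_empiricalMean_le hη hπ n ω
  have hint : ‖∫ x, (g x - g (π x)) ∂P‖ ≤ η := by
    simpa using norm_integral_le_of_norm_le_const (μ := P) (ae_of_all _ hπ)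
  have hsum : ‖∑ y ∈ π.range, setDeviation X P (π ⁻¹' {y}) n ω • g y‖ ≤
      C * ∑ y ∈ π.range, |setDeviation X P (π ⁻¹' {y}) n ω| := by
    rw [Finset.mul_sum]
    refine norm_sum_le_of_le _ fun y _ => ?_
    rw [norm_smul, Real.norm_eq_abs, mul_comm]
    exact mul_le_mul_of_nonneg_right (hC y) (abs_nonneg _)
  have hsplit : empiricalMean X n ω g - ∫ x, g x ∂P =
      empiricalMean X n ω (g - fun x => g (π x)) - ∫ x, (g x - g (π x)) ∂P +
        ∑ y ∈ π.range, setDeviation X P (π ⁻¹' {y}) n ω • g y := by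
    rw [← empiricalMean_comp_simpleFunc_sub_integral, empiricalMean_sub, integral_sub hg hgπ]
    abel
  rw [hsplit]
  refine (norm_add_le_of_le (norm_sub_le_of_le hemp hint) hsum).trans_eq ?_
  ring

end Deviation

/-- Uniformly bounded, uniformly Lipschitz functions on a compact space form a
Glivenko–Cantelli class. -/
theorem isGlivenkoCantelli_of_lipschitzWith
    {Ω 𝒳 Y : Type*} [MeasurableSpace Ω] [PseudoMetricSpace 𝒳] [CompactSpace 𝒳]
    [MeasurableSpace 𝒳] [BorelSpace 𝒳]
    [NormedAddCommGroup Y] [InnerProductSpace ℝ Y] [CompleteSpace Y]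
    {μ : Measure Ω} [IsProbabilityMeasure μ] {P : Measure 𝒳} {X : ℕ → Ω → 𝒳}
    (hX : ∀ i, Measurable (X i)) (hlaw : ∀ i, μ.map (X i) = P) (hindep : iIndepFun X μ)
    {𝒢 : Set (𝒳 → Y)} {L C : ℝ≥0} (hL : ∀ g ∈ 𝒢, LipschitzWith L g)
    (hC : ∀ g ∈ 𝒢, ∀ x, ‖g x‖ ≤ C) : IsGlivenkoCantelli μ X P 𝒢 := by
  have hP : IsProbabilityMeasure P := hlaw 0 ▸ Measure.isProbabilityMeasure_map (hX 0).aemeasurable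
  have : Nonempty 𝒳 := nonempty_of_isProbabilityMeasure P
  have hInt : ∀ g ∈ 𝒢, Integrable g P := fun g hg =>
    Integrable.of_bound (hL g hg).continuous.aestronglyMeasurable C (ae_of_all _ (hC g hg))
  refine ⟨hInt, fun ε hε => ?_⟩
  -- `ε` may be `⊤`, so a finite `r` below it is used.
  obtain ⟨r, hr0, hrε⟩ := ENNReal.lt_iff_exists_nnreal_btwn.1 hε
  have hr : (0 : ℝ) < r := by exact_mod_cast hr0
  -- This mesh gives `η = r / 4`; `L + 1` avoids dividing by zero.
  obtain ⟨π, hπ⟩ := exists_simpleFunc_dist_le (𝒳 := 𝒳) (δ := r / (4 * (L + 1))) (by positivity)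
  let D : ℕ → Ω → ℝ := fun n ω => ∑ y ∈ π.range, |setDeviation X P (π ⁻¹' {y}) n ω|
  have hDmeas : ∀ n, AEStronglyMeasurable (D n) μ := fun n =>
    (Finset.measurable_fun_sum _ fun y _ => (measurable_setDeviation hX
      (π.measurableSet_fiber y) n).abs).aestronglyMeasurable
  have hD : ∀ᵐ ω ∂μ, Tendsto (fun n => D n ω) atTop (𝓝 0) := by
    have h := (Finset.eventually_all π.range).2 fun y _ =>
      tendsto_setDeviation hX hlaw hindep (π.measurableSet_fiber y)
    filter_upwards [h] with ω hω
    simpa using tendsto_finsetSum π.range fun y hy => (hω y hy).abs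
  have hbound : ∀ n ω, empiricalDeviation X P 𝒢 n ω ≤ ENNReal.ofReal (r / 2 + C * D n ω) := by
    intro n ω
    refine iSup₂_le fun g hg => ?_
    rw [← ofReal_norm]
    refine ENNReal.ofReal_le_ofReal ?_
    refine (norm_empiricalMean_sub_integral_le (hInt g hg) (η := r / 4) (by positivity)
      (hC g hg) π (fun x => ?_) n ω).trans_eq (by ring)
    rw [← dist_eq_norm]
    calc dist (g x) (g (π x)) ≤ L * dist x (π x) := (hL g hg).dist_le_mul _ _
      _ ≤ (L + 1) * (r / (4 * (L + 1))) := by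
        rw [dist_comm]
        exact mul_le_mul (by linarith) (hπ x) dist_nonneg (by positivity)
      _ = r / 4 := by field_simp
  -- A deviation of at least `ε > r` forces `C * D > r / 2`, hence `D ≥ r / (2 * (C + 1))`. The
  -- possibly non-measurable event thus lies in one governed by `D`.
  have hconv := tendstoInMeasure_of_tendsto_ae (g := fun _ => (0 : ℝ)) hDmeas hD
    (ENNReal.ofReal (r / (2 * (C + 1)))) (ENNReal.ofReal_pos.2 (by positivity))
  refine tendsto_of_tendsto_of_tendsto_of_le_of_le tendsto_const_nhds hconv
    (fun _ => zero_le) fun n => measure_mono fun ω hω => ?_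
  have hD0 : 0 ≤ D n ω := Finset.sum_nonneg fun _ _ => abs_nonneg _
  have hlt : ENNReal.ofReal r < ENNReal.ofReal (r / 2 + C * D n ω) := by
    rw [ENNReal.ofReal_coe_nnreal]
    exact hrε.trans_le ((Set.mem_ofPred_eq ▸ hω).trans (hbound n ω))
  have hlt' := ((ENNReal.ofReal_lt_ofReal_iff_of_nonneg hr.le).1 hlt)
  rw [Set.mem_ofPred_eq, edist_dist, Real.dist_eq, sub_zero, abs_of_nonneg hD0]
  refine ENNReal.ofReal_le_ofReal ?_
  rw [div_le_iff₀ (by positivity)]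
  linarith

theorem mainTheorem4
    {Y : Type*} [NormedAddCommGroup Y] [InnerProductSpace ℝ Y] [CompleteSpace Y]
    [TopologicalSpace.SeparableSpace Y]
    (d m : ℕ) (hd : 1 ≤ d) (hm : 1 ≤ m)
    (B : Set Y)
    (hB : (TotallyBounded B ∧ IsHomogeneous B) ∨ upperBoxDim B < ⊤ ∨ HasExpCoveringNumbers B)
    {Ω : Type*} [MeasurableSpace Ω] (μ : Measure Ω) [IsProbabilityMeasure μ]
    (P : Measure (unitCube d)) (X : ℕ → Ω → unitCube d)
    (hX : ∀ i, Measurable (X i)) (hlaw : ∀ i, μ.map (X i) = P) (hindep : iIndepFun X μ) :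
    IsGlivenkoCantelli μ X P (smoothClass d m B) := by
  have hbdd : Bornology.IsBounded B := by
    rcases hB with ⟨h, -⟩ | h | h
    · exact h.isBounded
    · exact isBounded_of_upperBoxDim_lt_top h
    · exact h.isBounded
  obtain ⟨C, hC0, hC⟩ := hbdd.exists_pos_norm_le
  lift C to ℝ≥0 using hC0.le
  exact isGlivenkoCantelli_of_lipschitzWith hX hlaw hindep
    (fun g hg => lipschitzWith_of_mem_smoothClass hm hC hg) fun g hg x => hC _ (hg.2.1 x)
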